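/- **Setting.** Let $H$ be a reproducing kernel Hilbert space of real-valued functions on a set $X$, with reproducing kernel $k$ and feature map $\phi(x)=k(x,\cdot)\in H$. Fix points of $X$ representing the times $1,2,\dots$ (for example the integers themselves) and write $k(s,t)$, $\phi(t)$ for the values at the points representing $s,t$. Let $L(H,\mathbb R^d)$ be the bounded linear operators from $H$ to $\mathbb R^d$, with Hilbert–Schmidt norm $\|A\|_{HS}=(\sum_i\|Ah_i\|^2)^{1/2}$, $(h_i)$ any orthonormal basis of $H$. Let $G\ge 0$, $\epsilon>0$, $T\in\mathbb N$, put $G_0=G\max_{1\le t\le T}\sqrt{k(t,t)}$ and assume $G_0>0$. For $V>0$ and $S\ge 0$ let $\alpha(V)=\dfrac{\epsilon G_0}{\sqrt V\,\log^2(V/G_0^2)}$ and $$\Psi(S,V)=\begin{cases}\alpha(V)\left[\exp\left(\frac{S^2}{36V}\right)-1\right]&\text{if }S\le 6V/G_0,\\[1ex] \alpha(V)\left[\exp\left(\frac{S}{3G_0}-\frac{V}{G_0^2}\right)-1\right]&\text{otherwise.}\end{cases}$$ **Algorithm (kernelized parameter-free learning).** Start with $w_1=0$, $V_1=4G_0^2$,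 $S_1=0$. On round $t$ play $w_t\in\mathbb R^d$, receive $g_t\in\mathbb R^d$, and set $V_{t+1}=V_t+\|g_t\|^2k(t,t)$, $S_{t+1}^2=S_t^2+k(t,t)\|g_t\|^2+2\sum_{s=1}^{t-1}k(s,t)\langle g_t,g_s\rangle$ with $S_{t+1}\ge 0$, and $$w_{t+1}=\frac{-\sum_{s=1}^{t}k(s,t+1)\,g_s}{S_{t+1}}\,\Psi(S_{t+1},V_{t+1})\qquad(w_{t+1}=0\text{ if }S_{t+1}=0).$$ Its underlying operators are, with $G_s=g_s\otimes\phi(s)\in L(H,\mathbb R^d)$, i.e. $G_s h=\langle\phi(s),h\rangle g_s$, $$W_1=0,\qquad W_{t+1}=\frac{-\sum_{s=1}^tG_s}{\|\sum_{s=1}^tG_s\|_{HS}}\,\Psi\left(\Big\|\sum_{s=1}^tG_s\Big\|_{HS},\;4G_0^2+\sum_{s=1}^t\|G_s\|_{HS}^2\right)$$ (again $0$ if $\sum_{s=1}^tG_s=0$). **Proposition (KernelizedPF).** Let $\ell_1,\dots,\ell_T:\mathbb R^d\to\mathbb R$ be convex and $G$-Lipschitz for the Euclidean norm, and run the algorithm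 with $g_t\in\partial\ell_t(w_t)$ for $t=1,\dots,T$. Then for all $u_1,\dots,u_T\in\mathbb R^d$ and every $U\in L(H,\mathbb R^d)$ with $u_t=U\phi(t)$ for $t=1,\dots,T$, $$\sum_{t=1}^T\big(\ell_t(w_t)-\ell_t(u_t)\big)=\sum_{t=1}^T\big(\ell_t(W_t\phi(t))-\ell_t(U\phi(t))\big),$$ and $$\sum_{t=1}^T\big(\ell_t(w_t)-\ell_t(u_t)\big)\le 4G_0\epsilon+6\|U\|_{HS}\max\left\{\sqrt{V_{T+1}\log\left(\frac{\|U\|_{HS}}{\alpha_{T+1}}+1\right)},\;G_0\log\left(\frac{\|U\|_{HS}}{\alpha_{T+1}}+1\right)\right\},$$ where $V_{T+1}=4G_0^2+\sum_{t=1}^T\|g_t\|^2k(t,t)$ and $\alpha_{T+1}=\alpha(V_{T+1})$. -/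

import Mathlib

open scoped NNReal

noncomputable section

namespace KernelOCO

section Space

variable {X H : Type*} [NormedAddCommGroup H] [InnerProductSpace ℝ H] [CompleteSpace H]

/-- The feature map `φ(x) = k_x ∈ H` of a real-valued reproducing kernel Hilbert space: the Riesz
representer of the evaluation functional at `x`. -/
def feature (H : Type*) [NormedAddCommGroup H] [InnerProductSpace ℝ H] [CompleteSpace H]
    [RKHS ℝ H X ℝ] (x : X) : H :=
  RKHS.kerFun H x (1 : ℝ)

/-- The reproducing kernel `k(x, x') = k_x(x')`. -/
def repKernel (H : Type*) [NormedAddCommGroup H] [InnerProductSpace ℝ H] [CompleteSpace H]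
    [RKHS ℝ H X ℝ] (x x' : X) : ℝ :=
  (feature H x : X → ℝ) x'

/-- The reproducing property `⟪h, φ(x)⟫ = h(x)`. -/
theorem inner_feature [RKHS ℝ H X ℝ] (h : H) (x : X) :
    inner ℝ h (feature H x) = h x := by
  simp [feature]

theorem repKernel_eq_inner [RKHS ℝ H X ℝ] (x x' : X) :
    repKernel H x x' = inner ℝ (feature H x) (feature H x') := by
  rw [inner_feature]; rfl

/-- The Hilbert-Schmidt norm `(∑ᵢ ‖A hᵢ‖²)^(1/2)`, computed in some Hilbert basis `(hᵢ)` of `H`;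
by `hasSum_hsNorm_sq` the value is the same for every Hilbert basis. -/
def hsNorm {F : Type*} [NormedAddCommGroup F] [InnerProductSpace ℝ F] (A : H →L[ℝ] F) : ℝ :=
  Real.sqrt (∑' i, ‖A ((exists_hilbertBasis ℝ H).choose_spec.choose i)‖ ^ 2)

theorem hasSum_norm_sq_hilbertBasis {F : Type*} [NormedAddCommGroup F] [InnerProductSpace ℝ F]
    [FiniteDimensional ℝ F] (A : H →L[ℝ] F) {ι : Type*} (b : HilbertBasis ι ℝ H) :
    HasSum (fun i => ‖A (b i)‖ ^ 2)
      (∑ j, ‖ContinuousLinearMap.adjoint A (stdOrthonormalBasis ℝ F j)‖ ^ 2) := by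
  have h : ∀ j, HasSum (fun i => inner ℝ (stdOrthonormalBasis ℝ F j) (A (b i)) ^ 2)
      (‖ContinuousLinearMap.adjoint A (stdOrthonormalBasis ℝ F j)‖ ^ 2) := by
    intro j
    have := b.hasSum_inner_mul_inner (ContinuousLinearMap.adjoint A (stdOrthonormalBasis ℝ F j))
      (ContinuousLinearMap.adjoint A (stdOrthonormalBasis ℝ F j))
    rw [real_inner_self_eq_norm_sq] at this
    have e : (fun i => inner ℝ (stdOrthonormalBasis ℝ F j) (A (b i)) ^ 2) = fun i =>
        inner ℝ (ContinuousLinearMap.adjoint A (stdOrthonormalBasis ℝ F j)) (b i) *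
        inner ℝ (b i) (ContinuousLinearMap.adjoint A (stdOrthonormalBasis ℝ F j)) := by
      funext i
      rw [ContinuousLinearMap.adjoint_inner_left, ContinuousLinearMap.adjoint_inner_right,
        real_inner_comm (stdOrthonormalBasis ℝ F j) (A (b i)), sq]
    rw [e]
    exact this
  have e : (fun i => ‖A (b i)‖ ^ 2) = fun i =>
      ∑ j, inner ℝ (stdOrthonormalBasis ℝ F j) (A (b i)) ^ 2 := by
    funext i
    exact ((stdOrthonormalBasis ℝ F).sum_sq_inner_right (A (b i))).symm
  rw [e]
  exact hasSum_sum fun j _ => h j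

theorem hasSum_hsNorm_sq {F : Type*} [NormedAddCommGroup F] [InnerProductSpace ℝ F]
    [FiniteDimensional ℝ F] (A : H →L[ℝ] F) {ι : Type*} (b : HilbertBasis ι ℝ H) :
    HasSum (fun i => ‖A (b i)‖ ^ 2) (hsNorm A ^ 2) := by
  have h0 := hasSum_norm_sq_hilbertBasis A (exists_hilbertBasis ℝ H).choose_spec.choose
  rw [hsNorm, Real.sq_sqrt (tsum_nonneg fun i => sq_nonneg _), h0.tsum_eq]
  exact hasSum_norm_sq_hilbertBasis A b

end Space

section Regret

variable {E : Type*}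

/-- The subdifferential of `f` at `w`. -/
def subdifferential [NormedAddCommGroup E] [InnerProductSpace ℝ E] (f : E → ℝ) (w : E) : Set E :=
  {g | ∀ v, f w + inner ℝ g (v - w) ≤ f v}

/-- Dynamic regret over rounds `1, …, T` of the plays `w` against the comparator sequence `u`. -/
def dynamicRegret (T : ℕ) (ℓ : ℕ → E → ℝ) (w u : ℕ → E) : ℝ :=
  ∑ t ∈ Finset.Icc 1 T, (ℓ t (w t) - ℓ t (u t))

/-- Static regret over rounds `1, …, T` of the points `W` against the fixed comparator `U`. -/
def staticRegret (T : ℕ) (ℓ : ℕ → E → ℝ) (W : ℕ → E) (U : E) : ℝ :=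
  ∑ t ∈ Finset.Icc 1 T, (ℓ t (W t) - ℓ t U)

end Regret

section Algorithm

/-- The Lipschitz constant `G₀ = G · max_{1 ≤ t ≤ T} √k(t,t)` of the lifted losses. -/
def liftedLipschitz (k : ℕ → ℕ → ℝ) (G : ℝ) (T : ℕ) : ℝ :=
  G * ⨆ t : Finset.Icc 1 T, Real.sqrt (k t t)

/-- `α(V) = ε G₀ / (√V log²(V / G₀²))`. -/
def alpha (ε G₀ V : ℝ) : ℝ :=
  ε * G₀ / (Real.sqrt V * Real.log (V / G₀ ^ 2) ^ 2)

/-- The potential `Ψ(S, V)`. -/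
def potential (ε G₀ S V : ℝ) : ℝ :=
  if S ≤ 6 * V / G₀ then
    alpha ε G₀ V * (Real.exp (S ^ 2 / (36 * V)) - 1)
  else
    alpha ε G₀ V * (Real.exp (S / (3 * G₀) - V / G₀ ^ 2) - 1)

variable {E : Type*} [NormedAddCommGroup E] [InnerProductSpace ℝ E]

/-- `V₁ = 4 G₀²`, `V_{t+1} = V_t + ‖g_t‖² k(t,t)`. Rounds are numbered from `1`; index `0` is
unused here and below. -/
def algV (k : ℕ → ℕ → ℝ) (G₀ : ℝ) (g : ℕ → E) : ℕ → ℝ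
  | 0 => 4 * G₀ ^ 2
  | 1 => 4 * G₀ ^ 2
  | t + 2 => algV k G₀ g (t + 1) + ‖g (t + 1)‖ ^ 2 * k (t + 1) (t + 1)

/-- `S_t²`, where `S₁ = 0` and
`S_{t+1}² = S_t² + k(t,t) ‖g_t‖² + 2 ∑_{s=1}^{t-1} k(s,t) ⟪g_t, g_s⟫`. -/
def algSqS (k : ℕ → ℕ → ℝ) (g : ℕ → E) : ℕ → ℝ
  | 0 => 0
  | 1 => 0
  | t + 2 => algSqS k g (t + 1) + k (t + 1) (t + 1) * ‖g (t + 1)‖ ^ 2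
      + 2 * ∑ s ∈ Finset.Icc 1 t, k s (t + 1) * inner ℝ (g (t + 1)) (g s)

/-- `S_t ≥ 0`. -/
def algS (k : ℕ → ℕ → ℝ) (g : ℕ → E) (t : ℕ) : ℝ := Real.sqrt (algSqS k g t)

/-- The point played on round `t`, as a function of the subgradients `g₁, …, g_{t-1}`:
`w₁ = 0` and `w_{t+1} = -(∑_{s=1}^t k(s,t+1) g_s) Ψ(S_{t+1}, V_{t+1}) / S_{t+1}`
(which is `0` when `S_{t+1} = 0`). -/
def play (k : ℕ → ℕ → ℝ) (ε G₀ : ℝ) (g : ℕ → E) : ℕ → E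
  | 0 => 0
  | 1 => 0
  | t + 2 =>
      (potential ε G₀ (algS k g (t + 2)) (algV k G₀ g (t + 2)) / algS k g (t + 2)) •
        (-∑ s ∈ Finset.Icc 1 (t + 1), k s (t + 2) • g s)

/-- The operators `W_t ∈ L(H, E)` underlying the algorithm: with `G_s = g_s ⊗ φ(s)`, `W₁ = 0` and
`W_{t+1} = -(∑_{s=1}^t G_s) Ψ(‖∑_{s=1}^t G_s‖_HS, V_{t+1}) / ‖∑_{s=1}^t G_s‖_HS`, where
`V_{t+1} = 4 G₀² + ∑_{s=1}^t ‖G_s‖²_HS`. -/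
def operatorIterate {H : Type*} [NormedAddCommGroup H] [InnerProductSpace ℝ H] [CompleteSpace H]
    (φ : ℕ → H) (ε G₀ : ℝ) (g : ℕ → E) (t : ℕ) : H →L[ℝ] E :=
  let θ : H →L[ℝ] E := ∑ s ∈ Finset.Ico 1 t, InnerProductSpace.rankOne ℝ (g s) (φ s)
  let V : ℝ := 4 * G₀ ^ 2 +
    ∑ s ∈ Finset.Ico 1 t, hsNorm (InnerProductSpace.rankOne ℝ (g s) (φ s)) ^ 2
  (potential ε G₀ (hsNorm θ) V / hsNorm θ) • (-θ)

end Algorithm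

end KernelOCO

end

/-! The adjoint images of an orthonormal basis of the target embed the operators into a finite power
of `H`, isometrically for the Hilbert–Schmidt norm, and ⟨g ⊗ φ, A⟩ = ⟨g, Aφ⟩ there. The plays are
W_t φ(t), so the subgradient inequality reduces dynamic regret to the regret of the single vector
`U` against linear losses; division by G₀ gives them norm at most 1.

For linear losses z_t put θ = ∑ z_s and v = 4 + ∑ ‖z_s‖², and let Φ_v be `primitive`. The iterate is
minus the gradient of Φ_v(‖·‖) at θ. Raising v to v' = v + ‖z‖² lowers Φ enough to absorb the
second-order Taylor term of the step, up to 5ε‖z‖²/(v' log² v'), which telescopes against 1/log v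
(`primitive_step`, `error_le`). Hence Φ_v(‖θ‖) plus the accumulated loss stays below 5ε/log 4 ≤ 4ε,
and `mul_sub_primitive_le` bounds the remaining ‖U‖‖θ‖ − Φ_v(‖θ‖). -/

noncomputable section
namespace KernelOCO

/-! ### The normalized potential and its dependence on the scale -/

section Potential

/-- The slope `min (s / (18 v)) (1 / 3)` of `huber v` at `s`. -/
def clip (v s : ℝ) : ℝ := min (s / (18 * v)) (1 / 3)

/-- The exponent of the normalized potential, `max_{b ≤ 1/3} (b s - 9 v b²)`. -/
def huber (v s : ℝ) : ℝ := clip v s * s - 9 * v * clip v s ^ 2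

/-- The normalized prefactor `ε / (√v log² v)`. -/
def prefactor (ε v : ℝ) : ℝ := ε / (Real.sqrt v * Real.log v ^ 2)

/-- The normalized potential. -/
def normPotential (ε v s : ℝ) : ℝ := prefactor ε v * (Real.exp (huber v s) - 1)

/-- The primitive of the normalized potential which vanishes at `0`. -/
def primitive (ε v y : ℝ) : ℝ := ∫ s in (0 : ℝ)..y, normPotential ε v s

variable {ε v v' s t y S g : ℝ}

theorem clip_le : clip v s ≤ 1 / 3 := min_le_right _ _

theorem clip_nonneg (hv : 0 < v) (hs : 0 ≤ s) : 0 ≤ clip v s :=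
  le_min (by positivity) (by norm_num)

theorem clip_mono (hv : 0 < v) (h : s ≤ t) : clip v s ≤ clip v t := by
  unfold clip; gcongr

theorem clip_of_le (hv : 0 < v) (h : s ≤ 6 * v) : clip v s = s / (18 * v) := by
  refine min_eq_left ?_
  rw [div_le_iff₀ (by positivity)]; linarith

theorem clip_of_ge (hv : 0 < v) (h : 6 * v ≤ s) : clip v s = 1 / 3 := by
  refine min_eq_right ?_
  rw [le_div_iff₀ (by positivity)]; linarith

theorem clip_sub_le (hv : 0 < v) (h : s ≤ t) : clip v t ≤ clip v s + (t - s) / (18 * v) := by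
  have e : t / (18 * v) = s / (18 * v) + (t - s) / (18 * v) := by ring
  have : 0 ≤ (t - s) / (18 * v) := div_nonneg (by linarith) (by positivity)
  unfold clip
  rw [e, ← min_add_add_right]
  exact min_le_min le_rfl (by linarith)

theorem huber_of_le (hv : 0 < v) (h : s ≤ 6 * v) : huber v s = s ^ 2 / (36 * v) := by
  rw [huber, clip_of_le hv h]; field_simp; ring

theorem huber_of_ge (hv : 0 < v) (h : 6 * v ≤ s) : huber v s = s / 3 - v := by
  rw [huber, clip_of_ge hv h]; ring

/-- The dual description of the exponent: testing it with a suitable slope `b` yields convexity in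
`s`, monotonicity in `v` and every later lower bound without splitting into the two regimes. -/
theorem dual_le_huber (hv : 0 < v) {b : ℝ} (hb : b ≤ 1 / 3) :
    b * s - 9 * v * b ^ 2 ≤ huber v s := by
  rcases le_total s (6 * v) with h | h
  · rw [huber_of_le hv h, le_div_iff₀ (by positivity)]
    nlinarith [sq_nonneg (s - 18 * v * b)]
  · rw [huber_of_ge hv h]
    nlinarith [mul_nonneg (sub_nonneg.2 hb) (sub_nonneg.2 h), mul_nonneg hv.le (sq_nonneg (b - 1 / 3))]

theorem huber_nonneg (hv : 0 < v) : 0 ≤ huber v s := by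
  simpa using dual_le_huber (s := s) hv (b := 0) (by norm_num)

@[simp] theorem huber_zero (hv : 0 < v) : huber v 0 = 0 := by
  rw [huber_of_le hv (by positivity)]; simp

theorem huber_add_slope_le (hv : 0 < v) : huber v s + clip v s * (t - s) ≤ huber v t := by
  refine le_trans (le_of_eq ?_) (dual_le_huber hv (clip_le (v := v) (s := s)))
  rw [huber]; ring

theorem huber_mono (hv : 0 < v) (hs : 0 ≤ s) (h : s ≤ t) : huber v s ≤ huber v t := by
  have := huber_add_slope_le (s := s) (t := t) hv
  nlinarith [mul_nonneg (clip_nonneg hv hs) (sub_nonneg.2 h)]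

/-- Decreasing the scale `v'` to `v` increases the exponent. -/
theorem huber_add_le_of_scale (hv : 0 < v) :
    huber v' s + 9 * clip v' s ^ 2 * (v' - v) ≤ huber v s := by
  refine le_trans (le_of_eq ?_) (dual_le_huber hv (clip_le (v := v') (s := s)))
  rw [huber]; ring

/-- The slope optimal at `c * s` is tested at `s`; the penalty 9vb² only shrinks under
multiplication by `c ≤ 1`. -/
theorem huber_mul_le (hv : 0 < v) {c : ℝ} (h0 : 0 ≤ c) (h1 : c ≤ 1) :
    huber v (c * s) ≤ c * huber v s := by
  have h := dual_le_huber (s := s) hv (clip_le (v := v) (s := c * s))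
  have := mul_le_mul_of_nonneg_left h h0
  refine le_trans ?_ this
  rw [huber]
  nlinarith [mul_nonneg (sub_nonneg.2 h1) (mul_nonneg hv.le (sq_nonneg (clip v (c * s))))]

/-- The two regimes glue differentiably: the tangent inequalities at `s` and `t` trap the remainder
between 0 and (clip t − clip s)(t − s), which is quadratic because `clip v` is 1/(18v)-Lipschitz. -/
theorem hasDerivAt_huber (hv : 0 < v) (s : ℝ) : HasDerivAt (huber v) (clip v s) s := by
  rw [hasDerivAt_iff_isLittleO]
  refine Asymptotics.IsBigO.trans_isLittleO ?_ (Asymptotics.isLittleO_pow_sub_sub s one_lt_two)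
  refine Asymptotics.IsBigO.of_bound (1 / (18 * v)) (Filter.Eventually.of_forall fun t => ?_)
  have h1 := huber_add_slope_le (s := s) (t := t) hv
  have h2 := huber_add_slope_le (s := t) (t := s) hv
  have h3 : (clip v t - clip v s) * (t - s) ≤ (t - s) ^ 2 / (18 * v) := by
    have e : (t - s) ^ 2 / (18 * v) = (t - s) / (18 * v) * (t - s) := by ring
    rw [e]
    rcases le_total s t with h | h
    · exact mul_le_mul_of_nonneg_right (by linarith [clip_sub_le hv h]) (by linarith)
    · refine mul_le_mul_of_nonpos_right ?_ (by linarith)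
      have := clip_sub_le hv h
      have e : (t - s) / (18 * v) = -((s - t) / (18 * v)) := by ring
      linarith
  simp only [smul_eq_mul, norm_pow, Real.norm_eq_abs, sq_abs]
  rw [abs_of_nonneg (by linarith), one_div_mul_eq_div]
  linarith

theorem prefactor_pos (hε : 0 < ε) (hv : 1 < v) : 0 < prefactor ε v := by
  have := Real.log_pos hv
  unfold prefactor; positivity

theorem hasDerivAt_normPotential (hv : 0 < v) (s : ℝ) :
    HasDerivAt (normPotential ε v) (prefactor ε v * (Real.exp (huber v s) * clip v s)) s :=
  (((hasDerivAt_huber hv s).exp).sub_const 1).const_mul _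

theorem continuous_normPotential (hv : 0 < v) : Continuous (normPotential ε v) :=
  continuous_iff_continuousAt.2 fun s => (hasDerivAt_normPotential hv s).continuousAt

theorem hasDerivAt_primitive (hv : 0 < v) (y : ℝ) :
    HasDerivAt (primitive ε v) (normPotential ε v y) y :=
  intervalIntegral.integral_hasDerivAt_right ((continuous_normPotential hv).intervalIntegrable _ _)
    ((continuous_normPotential hv).stronglyMeasurableAtFilter _ _)
    (continuous_normPotential hv).continuousAt

@[simp] theorem primitive_zero : primitive ε v 0 = 0 := by simp [primitive]

@[simp] theorem normPotential_zero (hv : 0 < v) : normPotential ε v 0 = 0 := by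
  simp [normPotential, huber_zero hv]

theorem normPotential_nonneg (hε : 0 < ε) (hv : 1 < v) : 0 ≤ normPotential ε v s :=
  mul_nonneg (prefactor_pos hε hv).le
    (sub_nonneg.2 (Real.one_le_exp (huber_nonneg (by linarith))))

/-- A nonnegative derivative on the interior of a convex set gives `f a ≤ f b`. -/
theorem le_of_hasDerivAt_nonneg {f f' : ℝ → ℝ} {a b : ℝ} (hab : a ≤ b)
    (hf : ∀ s, HasDerivAt f (f' s) s) (h : ∀ s, a < s → s < b → 0 ≤ f' s) : f a ≤ f b := by
  refine monotoneOn_of_deriv_nonneg (convex_Icc a b)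
    (fun s _ => (hf s).continuousAt.continuousWithinAt)
    (fun s _ => (hf s).differentiableAt.differentiableWithinAt) (fun s hs => ?_)
    (Set.left_mem_Icc.2 hab) (Set.right_mem_Icc.2 hab) hab
  rw [interior_Icc] at hs
  rw [(hf s).deriv]; exact h s hs.1 hs.2

theorem primitive_nonneg (hε : 0 < ε) (hv : 1 < v) (hy : 0 ≤ y) : 0 ≤ primitive ε v y := by
  have := le_of_hasDerivAt_nonneg hy (hasDerivAt_primitive (ε := ε) (v := v) (by linarith))
    fun s _ _ => normPotential_nonneg hε hv
  simpa using this

/-- `s ↦ normPotential s / s` is monotone. -/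
theorem normPotential_mul_le (hε : 0 < ε) (hv : 1 < v) (hs : 0 ≤ s) (h : s ≤ t) :
    normPotential ε v s * t ≤ normPotential ε v t * s := by
  rcases hs.eq_or_lt with rfl | hs
  · simp [normPotential_zero (show 0 < v by linarith)]
  have ht : 0 < t := hs.trans_le h
  have hc0 : 0 ≤ s / t := by positivity
  have hc1 : s / t ≤ 1 := (div_le_one ht).2 h
  have h1 := huber_mul_le (v := v) (s := t) (by linarith) hc0 hc1
  rw [div_mul_cancel₀ _ ht.ne'] at h1
  have h2 := convexOn_exp.2 (Set.mem_univ (huber v t)) (Set.mem_univ 0) hc0 (sub_nonneg.2 hc1)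
    (by ring)
  simp only [smul_eq_mul, mul_zero, add_zero, Real.exp_zero, mul_one] at h2
  have h3 : Real.exp (huber v s) - 1 ≤ s / t * (Real.exp (huber v t) - 1) := by
    linarith [Real.exp_le_exp.2 h1]
  have h4 : (Real.exp (huber v s) - 1) * t ≤ s * (Real.exp (huber v t) - 1) := by
    have := mul_le_mul_of_nonneg_right h3 ht.le
    calc _ ≤ _ := this
      _ = _ := by field_simp
  unfold normPotential
  nlinarith [mul_le_mul_of_nonneg_left h4 (prefactor_pos hε hv).le]

/-- `q ↦ primitive (√q)` is convex. -/
theorem primitive_add_sq_le (hε : 0 < ε) (hv : 1 < v) (hs : 0 ≤ s) (ht : 0 ≤ t) :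
    primitive ε v s + normPotential ε v s / (2 * s) * (t ^ 2 - s ^ 2) ≤ primitive ε v t := by
  have hv0 : 0 < v := by linarith
  rcases hs.eq_or_lt with rfl | hs
  · simpa using primitive_nonneg hε hv ht
  -- This is the derivative of q ↦ `primitive` (√q) at q = s²; its limit as s → 0 is 0, in agreement
  -- with division by zero in the case above.
  set c := normPotential ε v s / (2 * s) with hc
  have hd : ∀ r, HasDerivAt (fun r => primitive ε v r - c * r ^ 2)
      (normPotential ε v r - c * (2 * r)) r := fun r =>
    ((hasDerivAt_primitive hv0 r).sub ((hasDerivAt_pow 2 r).const_mul c)).congr_deriv (by simp)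
  have e : ∀ r, c * (2 * r) = normPotential ε v s * r / s := fun r => by
    rw [hc]; field_simp
  rcases le_total s t with h | h
  · have := le_of_hasDerivAt_nonneg h hd fun r hr _ => by
      rw [e, sub_nonneg, div_le_iff₀ hs]
      exact normPotential_mul_le hε hv hs.le hr.le
    linarith
  · have := le_of_hasDerivAt_nonneg h (fun r => (hd r).neg) fun r hr hr' => by
      rw [e, neg_sub, sub_nonneg, le_div_iff₀ hs]
      exact normPotential_mul_le hε hv (ht.trans hr.le) hr'.le
    simp only [Pi.neg_apply] at this
    linarith

/-- The slope of the potential on `[0, m]`. -/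
theorem normPotential_sub_le (hε : 0 < ε) (hv : 1 < v) {m : ℝ} (hs : 0 ≤ s) (hst : s ≤ t)
    (htm : t ≤ m) : normPotential ε v t - normPotential ε v s ≤
      prefactor ε v * (Real.exp (huber v m) * clip v m) * (t - s) := by
  have hv0 : 0 < v := by linarith
  set M := prefactor ε v * (Real.exp (huber v m) * clip v m)
  have := le_of_hasDerivAt_nonneg (f := fun r => M * r - normPotential ε v r) hst
    (fun r => ((hasDerivAt_id r).const_mul M).sub (hasDerivAt_normPotential hv0 r))
    fun r h1 h2 => by
      have hr : 0 ≤ r := by linarith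
      rw [mul_one, sub_nonneg]
      have := huber_mono hv0 hr (h2.le.trans htm)
      have := clip_mono hv0 (h2.le.trans htm)
      have := clip_nonneg hv0 hr
      have := (prefactor_pos hε hv).le
      simp only [M]; gcongr
  linarith

theorem primitive_taylor (hε : 0 < ε) (hv : 1 < v) {m : ℝ} (hs : 0 ≤ s) (ht : 0 ≤ t)
    (hsm : s ≤ m) (htm : t ≤ m) :
    primitive ε v t ≤ primitive ε v s + normPotential ε v s * (t - s) +
      prefactor ε v * (Real.exp (huber v m) * clip v m) * (t - s) ^ 2 / 2 := by
  have hv0 : 0 < v := by linarith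
  set M := prefactor ε v * (Real.exp (huber v m) * clip v m) with hM
  have hd : ∀ r, HasDerivAt (fun r => normPotential ε v s * (r - s) + M / 2 * (r - s) ^ 2
      - primitive ε v r) (normPotential ε v s + M * (r - s) - normPotential ε v r) r := fun r => by
    have h1 := ((hasDerivAt_id r).sub_const s)
    have h2 := ((h1.const_mul (normPotential ε v s)).add ((h1.pow 2).const_mul (M / 2))).sub
      (hasDerivAt_primitive (ε := ε) hv0 r)
    refine h2.congr_deriv ?_
    simp; ring
  rcases le_total s t with h | h
  · have := le_of_hasDerivAt_nonneg h hd fun r h1 h2 => by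
      linarith [normPotential_sub_le hε hv hs h1.le (h2.le.trans htm)]
    linarith
  · have := le_of_hasDerivAt_nonneg h (fun r => (hd r).neg) fun r h1 h2 => by
      linarith [normPotential_sub_le hε hv (ht.trans h1.le) h2.le hsm]
    simp only [Pi.neg_apply] at this
    linarith

/-- The same second-order bound when the step from `S` of length `g` crosses `0`. -/
theorem primitive_taylor_abs_sub (hε : 0 < ε) (hv : 1 < v) {m : ℝ} (hS : 0 ≤ S)
    (hSm : S ≤ m) (hgm : |S - g| ≤ m) :
    primitive ε v |S - g| ≤ primitive ε v S - normPotential ε v S * g +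
      prefactor ε v * (Real.exp (huber v m) * clip v m) * g ^ 2 / 2 := by
  have hv0 : 0 < v := by linarith
  rcases le_total g S with h | h
  · rw [abs_of_nonneg (by linarith)] at *
    have := primitive_taylor hε hv hS (sub_nonneg.2 h) hSm hgm
    have e : S - g - S = -g := by ring
    rw [e, neg_sq] at this
    linarith
  · rw [abs_of_nonpos (by linarith)] at *
    have hm : 0 ≤ m := hS.trans hSm
    -- The path is cut at 0. The errors (g − S)²/2 and S²/2 of the two pieces and the mixed term S(g
    -- − S) from `h4` add up to g²/2.
    have h1 := primitive_taylor hε hv le_rfl (show 0 ≤ -(S - g) by linarith) hm hgm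
    have h2 := primitive_taylor hε hv hS le_rfl hSm hm
    have h3 := normPotential_sub_le hε hv le_rfl hS hSm
    have h4 := mul_le_mul_of_nonneg_right h3 (show 0 ≤ g - S by linarith)
    simp only [normPotential_zero hv0, primitive_zero] at h1 h2 h3 h4
    nlinarith

/-- Only the factor 1/√v is exploited, through (1 − u)(1 + u/2)² ≤ 1 with u = (v' − v)/v'; the
logarithm merely has the right monotonicity. -/
theorem prefactor_scale_le (hε : 0 < ε) (hv : 1 < v) (h : v ≤ v') :
    prefactor ε v' * (1 + (v' - v) / v' / 2) ≤ prefactor ε v := by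
  have hv0 : 0 < v := by linarith
  have hv'0 : 0 < v' := by linarith
  have hl : 0 < Real.log v := Real.log_pos hv
  have hl' : Real.log v ≤ Real.log v' := Real.log_le_log hv0 h
  have hu : 0 ≤ (v' - v) / v' := div_nonneg (by linarith) hv'0.le
  have hu1 : (v' - v) / v' ≤ 1 := (div_le_one hv'0).2 (by linarith)
  have h1 : Real.sqrt v * (1 + (v' - v) / v' / 2) ≤ Real.sqrt v' := by
    refine Real.le_sqrt_of_sq_le ?_
    rw [mul_pow, Real.sq_sqrt hv0.le]
    have e : v = v' * (1 - (v' - v) / v') := by field_simp; ring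
    set u := (v' - v) / v'
    rw [e, mul_assoc]
    refine mul_le_of_le_one_right hv'0.le ?_
    nlinarith [mul_nonneg hu hu, mul_nonneg (mul_nonneg hu hu) hu]
  have hl'0 : 0 < Real.log v' := hl.trans_le hl'
  unfold prefactor
  have hs : 0 < Real.sqrt v := Real.sqrt_pos.2 hv0
  have hs' : 0 < Real.sqrt v' := Real.sqrt_pos.2 hv'0
  rw [div_mul_eq_mul_div, div_le_div_iff₀ (by positivity) (by positivity), mul_assoc]
  refine mul_le_mul_of_nonneg_left ?_ hε.le
  calc (1 + (v' - v) / v' / 2) * (Real.sqrt v * Real.log v ^ 2)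
      = Real.sqrt v * (1 + (v' - v) / v' / 2) * Real.log v ^ 2 := by ring
    _ ≤ Real.sqrt v' * Real.log v' ^ 2 := by gcongr

/-- The prefactor and the exponent each contribute a gain, and their cross term is dropped. For 0 ≤
s ≤ 6v' the bracket is exactly 9 times the derivative of clip · (exp huber − 1), ready to be
integrated. -/
theorem normPotential_scale_le (hε : 0 < ε) (hv : 1 < v) (h : v ≤ v') :
    normPotential ε v' s + (v' - v) * prefactor ε v' * ((Real.exp (huber v' s) - 1) / (2 * v') +
      9 * clip v' s ^ 2 * Real.exp (huber v' s)) ≤ normPotential ε v s := by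
  have hv0 : 0 < v := by linarith
  have hv'0 : 0 < v' := by linarith
  have h1 := prefactor_scale_le hε hv h
  have h2 := huber_add_le_of_scale (v' := v') (s := s) hv0
  have hp := prefactor_pos hε (hv.trans_le h)
  have hq : 0 ≤ 9 * clip v' s ^ 2 * (v' - v) :=
    mul_nonneg (by positivity) (by linarith)
  have hu : 0 ≤ (v' - v) / v' / 2 := by
    have := sub_nonneg.2 h
    positivity
  have hE : 1 ≤ Real.exp (huber v' s) := Real.one_le_exp (huber_nonneg hv'0)
  have h3 : Real.exp (huber v' s) * (1 + 9 * clip v' s ^ 2 * (v' - v)) ≤ Real.exp (huber v s) := by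
    refine le_trans ?_ (Real.exp_le_exp.2 h2)
    rw [Real.exp_add]
    gcongr
    linarith [Real.add_one_le_exp (9 * clip v' s ^ 2 * (v' - v))]
  have h4 : prefactor ε v' * (1 + (v' - v) / v' / 2) *
      (Real.exp (huber v' s) * (1 + 9 * clip v' s ^ 2 * (v' - v)) - 1) ≤ normPotential ε v s := by
    unfold normPotential
    refine mul_le_mul h1 (by linarith) ?_ (prefactor_pos hε hv).le
    nlinarith [mul_nonneg (zero_le_one.trans hE) hq]
  refine le_trans ?_ h4
  unfold normPotential
  have e : (v' - v) * prefactor ε v' * ((Real.exp (huber v' s) - 1) / (2 * v') +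
      9 * clip v' s ^ 2 * Real.exp (huber v' s)) = prefactor ε v' *
      ((v' - v) / v' / 2 * (Real.exp (huber v' s) - 1) +
      9 * clip v' s ^ 2 * (v' - v) * Real.exp (huber v' s)) := by field_simp
  rw [e, ← mul_add, mul_assoc (prefactor ε v')]
  refine mul_le_mul_of_nonneg_left ?_ hp.le
  nlinarith [mul_nonneg hu (mul_nonneg hq (zero_le_one.trans hE))]

/-- The gain of the primitive from increasing the scale. -/
theorem primitive_scale_le (hε : 0 < ε) (hv : 1 < v) (h : v ≤ v') (hy : 0 ≤ y) :
    primitive ε v' y + 9 * (v' - v) * prefactor ε v' * clip v' y * (Real.exp (huber v' y) - 1) ≤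
      primitive ε v y := by
  have hv0 : 0 < v := by linarith
  have hv'0 : 0 < v' := by linarith
  have hp := prefactor_pos hε (hv.trans_le h)
  have hvv : 0 ≤ v' - v := by linarith
  have hE : ∀ s, HasDerivAt (fun s => Real.exp (huber v' s) - 1)
      (Real.exp (huber v' s) * clip v' s) s := fun s => ((hasDerivAt_huber hv'0 s).exp).sub_const 1
  set c := 9 * (v' - v) * prefactor ε v'
  have small : ∀ y, 0 ≤ y → y ≤ 6 * v' → primitive ε v' y +
      c * clip v' y * (Real.exp (huber v' y) - 1) ≤ primitive ε v y := by
    intro y hy hy6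
    have := le_of_hasDerivAt_nonneg (f := fun s => primitive ε v s - primitive ε v' s -
      c * (s / (18 * v') * (Real.exp (huber v' s) - 1))) hy
      (fun s => ((hasDerivAt_primitive hv0 s).sub (hasDerivAt_primitive hv'0 s)).sub
        ((((hasDerivAt_id s).div_const _).mul (hE s)).const_mul c)) fun s h1 h2 => by
          have h3 := normPotential_scale_le (s := s) hε hv h
          have e := clip_of_le hv'0 (h2.le.trans hy6)
          simp only [id]
          rw [← e]
          have : c * (1 / (18 * v') * (Real.exp (huber v' s) - 1) +
            clip v' s * (Real.exp (huber v' s) * clip v' s)) = (v' - v) * prefactor ε v' *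
            ((Real.exp (huber v' s) - 1) / (2 * v') +
              9 * clip v' s ^ 2 * Real.exp (huber v' s)) := by
            simp only [c]; field_simp; ring
          linarith
    simp only [primitive_zero, zero_div, zero_mul, mul_zero, sub_zero] at this
    rw [clip_of_le hv'0 hy6]
    linarith
  rcases le_total y (6 * v') with h6 | h6
  · exact small y hy h6
  · have h0 := small (6 * v') (by positivity) le_rfl
    -- Beyond 6v' the clip is constant, so only the second gain is needed and the first is surplus.
    have := le_of_hasDerivAt_nonneg (f := fun s => primitive ε v s - primitive ε v' s -
      c * (1 / 3 * (Real.exp (huber v' s) - 1))) h6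
      (fun s => ((hasDerivAt_primitive hv0 s).sub (hasDerivAt_primitive hv'0 s)).sub
        (((hE s).const_mul (1 / 3)).const_mul c)) fun s h1 h2 => by
          have h3 := normPotential_scale_le (s := s) hε hv h
          rw [clip_of_ge hv'0 h1.le] at h3 ⊢
          have h4 : 0 ≤ (v' - v) * prefactor ε v' * ((Real.exp (huber v' s) - 1) / (2 * v')) :=
            mul_nonneg (by positivity) (div_nonneg
              (sub_nonneg.2 (Real.one_le_exp (huber_nonneg hv'0))) (by positivity))
          simp only [c]
          nlinarith
    rw [clip_of_ge hv'0 le_rfl] at h0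
    rw [clip_of_ge hv'0 h6]
    linarith

end Potential

/-! ### One step of the potential argument, and the dual bound -/

section Step

variable {ε v v' s t y S g : ℝ}

theorem lt_log_of_four_le {x : ℝ} (hx : 4 ≤ x) : 27 / 20 < Real.log x := by
  have h1 : Real.log 4 = 2 * Real.log 2 := by
    rw [show (4 : ℝ) = 2 ^ 2 by norm_num, Real.log_pow]; norm_num
  have h2 : Real.log 4 ≤ Real.log x := Real.log_le_log (by norm_num) hx
  linarith [Real.log_two_gt_d9]

theorem exp_four_thirds_le : Real.exp (4 / 3) ≤ 4 := by
  refine le_of_pow_le_pow_left₀ (n := 3) (by norm_num) (by norm_num) ?_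
  rw [← Real.exp_nat_mul, show ((3 : ℕ) : ℝ) * (4 / 3) = (4 : ℕ) * 1 by norm_num,
    Real.exp_nat_mul]
  have h := Real.exp_one_lt_d9
  calc Real.exp 1 ^ 4 ≤ 2.7182818286 ^ 4 := by gcongr
    _ ≤ 4 ^ 3 := by norm_num

theorem prefactor_le_of_scale (hε : 0 < ε) (hv : 4 ≤ v) (h : v ≤ v') (h' : v' ≤ v + 1) :
    prefactor ε v ≤ 8 / 5 * prefactor ε v' := by
  have hv0 : 0 < v := by linarith
  have hv'0 : 0 < v' := by linarith
  have hl : 27 / 20 < Real.log v := lt_log_of_four_le hv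
  have hl0 : 0 < Real.log v := by linarith
  -- The increase is at most 1/4, which is below 19/100 · 27/20.
  have hl' : Real.log v' ≤ 119 / 100 * Real.log v := by
    have h1 : Real.log (v' / v) ≤ v' / v - 1 := Real.log_le_sub_one_of_pos (by positivity)
    rw [Real.log_div hv'0.ne' hv0.ne'] at h1
    have h2 : v' / v ≤ 5 / 4 := by rw [div_le_iff₀ hv0]; linarith
    linarith
  have hl'0 : 0 < Real.log v' := Real.log_pos (by linarith)
  have hs' : Real.sqrt v' ≤ 1119 / 1000 * Real.sqrt v := by
    rw [Real.sqrt_le_left (by positivity), mul_pow, Real.sq_sqrt hv0.le]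
    linarith
  have hs : 0 < Real.sqrt v := Real.sqrt_pos.2 hv0
  have hs'0 : 0 < Real.sqrt v' := Real.sqrt_pos.2 hv'0
  unfold prefactor
  rw [← mul_div_assoc, div_le_div_iff₀ (by positivity) (by positivity)]
  calc ε * (Real.sqrt v' * Real.log v' ^ 2)
      ≤ ε * ((1119 / 1000 * Real.sqrt v) * (119 / 100 * Real.log v) ^ 2) := by gcongr
    _ = (1119 / 1000 * (119 / 100) ^ 2) * (ε * (Real.sqrt v * Real.log v ^ 2)) := by ring
    _ ≤ 8 / 5 * (ε * (Real.sqrt v * Real.log v ^ 2)) := by gcongr; norm_num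
    _ = _ := by ring

/-- Left is the curvature after constants are collected, right the gain from the scale plus an
error. The gain dominates where the exponential is large; it fails only for y of order √v, where the
slope is of order 1/√v. -/
theorem exp_huber_mul_clip_le (hv : 4 ≤ v) (hy : 0 ≤ y) :
    4 * Real.exp (huber v y) * (clip v y + 1 / (18 * v)) ≤
      9 * clip v y * (Real.exp (huber v y) - 1) + 5 / Real.sqrt v := by
  have hv0 : 0 < v := by linarith
  obtain ⟨r, hr, rfl⟩ : ∃ r, 2 ≤ r ∧ v = r ^ 2 :=
    ⟨Real.sqrt v, Real.le_sqrt_of_sq_le (by linarith), (Real.sq_sqrt hv0.le).symm⟩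
  have hr0 : 0 < r := by linarith
  rw [Real.sqrt_sq hr0.le]
  rcases le_total y (6 * r ^ 2) with h | h
  · rw [clip_of_le hv0 h]
    set E := Real.exp (huber (r ^ 2) y) with hE
    -- The claim multiplied by 18v.
    have key : 4 * E * (y + 1) ≤ 9 * y * (E - 1) + 90 * r := by
      rcases le_total y 1 with h1 | h1
      · have hh : huber (r ^ 2) y ≤ 1 := by
          rw [huber_of_le hv0 h, div_le_one (by positivity)]; nlinarith
        have hE3 : E ≤ 3 := (Real.exp_le_exp.2 hh).trans (by linarith [Real.exp_one_lt_d9])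
        have : 0 ≤ y * E := mul_nonneg hy (Real.exp_pos _).le
        nlinarith
      · have hE1 : 1 + y ^ 2 / (36 * r ^ 2) ≤ E := by
          rw [← huber_of_le hv0 h]; linarith [Real.add_one_le_exp (huber (r ^ 2) y)]
        set q := y ^ 2 / (36 * r ^ 2) with hq
        have hq0 : 0 ≤ q := by positivity
        have h2 : (5 * y - 4) * (1 + q) ≤ (5 * y - 4) * E :=
          mul_le_mul_of_nonneg_left hE1 (by linarith)
        have h3 : 4 * y ≤ y * q + 86 * r := by
          rcases le_total y (20 * r) with h4 | h4
          · nlinarith [mul_nonneg hy hq0]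
          · have : 4 ≤ q := by
              rw [hq, le_div_iff₀ (by positivity)]; nlinarith
            nlinarith
        nlinarith [mul_nonneg (sub_nonneg.2 h1) hq0]
    have e1 : 4 * E * (y / (18 * r ^ 2) + 1 / (18 * r ^ 2)) = 4 * E * (y + 1) / (18 * r ^ 2) := by
      ring
    have e2 : 9 * (y / (18 * r ^ 2)) * (E - 1) + 5 / r =
        (9 * y * (E - 1) + 90 * r) / (18 * r ^ 2) := by field_simp; ring
    rw [e1, e2]
    gcongr
  · rw [clip_of_ge hv0 h]
    have hh : 4 ≤ huber (r ^ 2) y := by rw [huber_of_ge hv0 h]; linarith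
    have hE : 5 ≤ Real.exp (huber (r ^ 2) y) := by
      linarith [Real.add_one_le_exp (huber (r ^ 2) y)]
    have h1 : 1 / (18 * r ^ 2) ≤ 1 / 72 := by
      apply one_div_le_one_div_of_le (by norm_num); linarith
    have h2 : 0 < 5 / r := by positivity
    nlinarith

/-- One step changes everything by bounded factors: the exponent by at most 1/3 + 1, so the
exponential by 4; the slope by 5/4 up to a shift; the prefactor by 8/5. With the 1/2 the product is
the 4 of `exp_huber_mul_clip_le`. -/
theorem curvature_le (hε : 0 < ε) (hv : 4 ≤ v) (h : v ≤ v') (h' : v' ≤ v + 1) {m : ℝ}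
    (hy : 0 ≤ y) (hym : y ≤ m) (hmy : m ≤ y + 1) :
    prefactor ε v * (Real.exp (huber v m) * clip v m) / 2 ≤
      9 * prefactor ε v' * clip v' y * (Real.exp (huber v' y) - 1) +
        5 * prefactor ε v' / Real.sqrt v' := by
  have hv0 : 0 < v := by linarith
  have hv'0 : 0 < v' := by linarith
  have hp := prefactor_pos hε (show 1 < v' by linarith)
  have hc : 0 ≤ clip v y := clip_nonneg hv0 hy
  have hc' : 0 ≤ clip v' y := clip_nonneg hv'0 hy
  have h1 : huber v m ≤ huber v y + 1 / 3 := by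
    have h2 := huber_add_slope_le (s := m) (t := y) hv0
    nlinarith [clip_le (v := v) (s := m), clip_nonneg hv0 (hy.trans hym)]
  have h2 : huber v y ≤ huber v' y + 1 := by
    have h3 := huber_add_le_of_scale (v' := v) (s := y) hv'0
    nlinarith [clip_le (v := v) (s := y), mul_nonneg hc (sub_nonneg.2 h)]
  have h3 : Real.exp (huber v m) ≤ 4 * Real.exp (huber v' y) := by
    calc Real.exp (huber v m) ≤ Real.exp (4 / 3 + huber v' y) := by gcongr; linarith
      _ ≤ _ := by rw [Real.exp_add]; gcongr; exact exp_four_thirds_le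
  have h4 : ∀ x, 0 ≤ x → x / (18 * v) ≤ 5 / 4 * (x / (18 * v')) := fun x hx => by
    have e : 5 / 4 * (x / (18 * v')) = x / (18 * (4 / 5 * v')) := by field_simp
    rw [e]
    gcongr
    linarith
  have h5 : clip v y ≤ 5 / 4 * clip v' y := by
    unfold clip
    rcases le_total (y / (18 * v')) (1 / 3) with h6 | h6
    · rw [min_eq_left h6]; exact (min_le_left _ _).trans (h4 y hy)
    · rw [min_eq_right h6]; exact (min_le_right _ _).trans (by norm_num)
  have h6 : clip v m ≤ 5 / 4 * (clip v' y + 1 / (18 * v')) := by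
    have h7 := clip_sub_le hv0 hym
    have h8 : (m - y) / (18 * v) ≤ 1 / (18 * v) := by gcongr; linarith
    linarith [h4 1 zero_le_one]
  have h7 := prefactor_le_of_scale hε hv h h'
  have h8 := mul_le_mul_of_nonneg_left (exp_huber_mul_clip_le (v := v') (by linarith) hy) hp.le
  calc prefactor ε v * (Real.exp (huber v m) * clip v m) / 2
      ≤ (8 / 5 * prefactor ε v') * ((4 * Real.exp (huber v' y)) *
        (5 / 4 * (clip v' y + 1 / (18 * v')))) / 2 := by
        have := clip_nonneg hv0 (hy.trans hym)
        gcongr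
    _ = prefactor ε v' * (4 * Real.exp (huber v' y) * (clip v' y + 1 / (18 * v'))) := by ring
    _ ≤ _ := h8
    _ = _ := by ring

/-- Since the scale grows by exactly g², the gain of `primitive_scale_le` cancels the main part of
the curvature term. -/
theorem primitive_step_of_taylor (hε : 0 < ε) (hv : 4 ≤ v) (hg : g ^ 2 ≤ 1) {m a : ℝ}
    (hy : 0 ≤ y) (hym : y ≤ m) (hmy : m ≤ y + 1)
    (h : primitive ε v y ≤ a + prefactor ε v * (Real.exp (huber v m) * clip v m) * g ^ 2 / 2) :
    primitive ε (v + g ^ 2) y ≤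
      a + 5 * prefactor ε (v + g ^ 2) / Real.sqrt (v + g ^ 2) * g ^ 2 := by
  have h0 : v ≤ v + g ^ 2 := by linarith [sq_nonneg g]
  have h1 := primitive_scale_le (v' := v + g ^ 2) hε (show 1 < v by linarith) h0 hy
  have h2 := mul_le_mul_of_nonneg_right
    (curvature_le hε hv h0 (by linarith) hy hym hmy) (sq_nonneg g)
  rw [add_sub_cancel_left] at h1
  linarith

theorem primitive_step_add (hε : 0 < ε) (hv : 4 ≤ v) (hS : 0 ≤ S) (hg : 0 ≤ g) (hg1 : g ≤ 1) :
    primitive ε (v + g ^ 2) (S + g) ≤ primitive ε v S + normPotential ε v S * g +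
      5 * prefactor ε (v + g ^ 2) / Real.sqrt (v + g ^ 2) * g ^ 2 := by
  refine primitive_step_of_taylor (m := S + g) hε hv (by nlinarith) (by linarith) le_rfl
    (by linarith) ?_
  have := primitive_taylor (t := S + g) (m := S + g) hε (show 1 < v by linarith) hS
    (by linarith) (by linarith) le_rfl
  rwa [add_sub_cancel_left] at this

theorem primitive_step_sub (hε : 0 < ε) (hv : 4 ≤ v) (hS : 0 ≤ S) (hg : 0 ≤ g) (hg1 : g ≤ 1) :
    primitive ε (v + g ^ 2) |S - g| ≤ primitive ε v S - normPotential ε v S * g +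
      5 * prefactor ε (v + g ^ 2) / Real.sqrt (v + g ^ 2) * g ^ 2 := by
  have h1 : S ≤ |S - g| + 1 := by linarith [le_abs_self (S - g)]
  exact primitive_step_of_taylor (m := max S |S - g|) hε hv (by nlinarith) (abs_nonneg _)
    (le_max_right _ _) (max_le h1 (by linarith))
    (primitive_taylor_abs_sub hε (by linarith) hS (le_max_left _ _) (le_max_right _ _))

/-- One step of the potential argument, for a step of length `g` in an arbitrary direction. -/
theorem primitive_step (hε : 0 < ε) (hv : 4 ≤ v) {x p : ℝ} (hS : 0 ≤ S) (hg : 0 ≤ g)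
    (hg1 : g ≤ 1) (hx : 0 ≤ x) (hp : |p| ≤ S * g) (hxp : x ^ 2 = S ^ 2 + 2 * p + g ^ 2) :
    primitive ε (v + g ^ 2) x ≤ primitive ε v S + normPotential ε v S / S * p +
      5 * prefactor ε (v + g ^ 2) / Real.sqrt (v + g ^ 2) * g ^ 2 := by
  have hadd := primitive_step_add hε hv hS hg hg1
  have hsub := primitive_step_sub hε hv hS hg hg1
  rcases (mul_nonneg hS hg).eq_or_lt with h0 | h0
  -- If S = 0 the quotient by `S` is 0 by convention, consistent with `normPotential_zero`.
  · have hp0 : p = 0 := abs_nonpos_iff.1 (hp.trans h0.ge)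
    have hx' : x = S + g := by
      rw [← sq_eq_sq₀ hx (by linarith)]; rw [hxp, hp0]; nlinarith
    rcases mul_eq_zero.1 h0.symm with h | h
    · subst h
      rw [hx', hp0]
      rw [normPotential_zero (by linarith)] at hadd
      simpa using hadd
    · subst h
      rw [hx', hp0]
      simp
  · have hS0 : 0 < S := pos_of_mul_pos_left h0 hg
    have hg0 : 0 < g := pos_of_mul_pos_right h0 hS
    obtain ⟨h1, h2⟩ := abs_le.1 hp
    have ha := primitive_add_sq_le (v := v + g ^ 2) hε (by nlinarith) hx
      (show 0 ≤ S + g by linarith)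
    have hb := primitive_add_sq_le (v := v + g ^ 2) hε (by nlinarith) hx (abs_nonneg (S - g))
    rw [sq_abs] at hb
    set c := normPotential ε (v + g ^ 2) x / (2 * x)
    -- The weight for which x² = l(S + g)² + (1 − l)(S − g)². Convexity in x² and affinity of the
    -- bound in `p` leave only the two collinear steps.
    set l := (1 + p / (S * g)) / 2 with hl
    have hpl : p = (2 * l - 1) * (S * g) := by rw [hl]; field_simp; ring
    have hl0 : 0 ≤ l := by
      have : -1 ≤ p / (S * g) := by rw [le_div_iff₀ h0]; linarith
      linarith
    have hl1 : l ≤ 1 := by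
      have : p / (S * g) ≤ 1 := by rw [div_le_iff₀ h0]; linarith
      linarith
    have e : normPotential ε v S / S * p = (2 * l - 1) * (normPotential ε v S * g) := by
      rw [hpl]; field_simp
    rw [e]
    have e2 : l * (c * ((S + g) ^ 2 - x ^ 2)) + (1 - l) * (c * ((S - g) ^ 2 - x ^ 2)) = 0 := by
      rw [hxp, hpl]; ring
    have ha' := mul_le_mul_of_nonneg_left (ha.trans hadd) hl0
    have hb' := mul_le_mul_of_nonneg_left (hb.trans hsub) (sub_nonneg.2 hl1)
    linarith

/-- The error terms telescope. -/
theorem error_le (hε : 0 < ε) (hv : 4 ≤ v) :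
    5 * prefactor ε (v + g ^ 2) / Real.sqrt (v + g ^ 2) * g ^ 2 ≤
      5 * ε * (1 / Real.log v - 1 / Real.log (v + g ^ 2)) := by
  set w := v + g ^ 2 with hw
  have hg : g ^ 2 = w - v := by rw [hw]; ring
  have hvw : v ≤ w := by linarith [sq_nonneg g]
  have hv0 : 0 < v := by linarith
  have hw0 : 0 < w := by linarith
  have hl : 0 < Real.log v := Real.log_pos (by linarith)
  have hll : Real.log v ≤ Real.log w := Real.log_le_log hv0 hvw
  have hl' : 0 < Real.log w := hl.trans_le hll
  -- The left side is g²/w, the increment in the error ε g²/(w log² w).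
  have h1 : 1 - v / w ≤ Real.log w - Real.log v := by
    have := Real.log_le_sub_one_of_pos (div_pos hv0 hw0)
    rw [Real.log_div hv0.ne' hw0.ne'] at this
    linarith
  have hs : 0 < Real.sqrt w := Real.sqrt_pos.2 hw0
  have e1 : 5 * prefactor ε w / Real.sqrt w * g ^ 2 = 5 * ε * ((1 - v / w) / Real.log w ^ 2) := by
    unfold prefactor
    have : (1 - v / w) = g ^ 2 / Real.sqrt w ^ 2 := by
      rw [Real.sq_sqrt hw0.le, hg]; field_simp
    rw [this]; field_simp
  have e2 : 1 / Real.log v - 1 / Real.log w =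
      (Real.log w - Real.log v) / (Real.log v * Real.log w) := by field_simp
  rw [e1, e2]
  gcongr
  rw [sq]; gcongr

/-- The Fenchel-type bound for the potential. -/
theorem mul_sub_primitive_le (hε : 0 < ε) (hv : 1 < v) {r : ℝ} (hr : 0 ≤ r) (hS : 0 ≤ S) :
    S * r - primitive ε v S ≤
      6 * r * max (Real.sqrt (v * Real.log (r / prefactor ε v + 1)))
        (Real.log (r / prefactor ε v + 1)) := by
  have hv0 : 0 < v := by linarith
  have hp := prefactor_pos hε hv
  set L := Real.log (r / prefactor ε v + 1) with hL
  have hL0 : 0 ≤ L := Real.log_nonneg (by linarith [div_nonneg hr hp.le])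
  have hexp : Real.exp L = r / prefactor ε v + 1 :=
    Real.exp_log (by linarith [div_nonneg hr hp.le])
  set M := max (Real.sqrt (v * L)) L with hM
  have hM0 : 0 ≤ M := hL0.trans (le_max_right _ _)
  -- Past 6M the slope of the primitive exceeds `r`, so S r − `primitive` cannot grow further.
  have hψ : ∀ s, 6 * M ≤ s → r ≤ normPotential ε v s := by
    intro s hs
    have hh : L ≤ huber v s := by
      rcases le_total L v with h | h
      · set x := Real.sqrt (L / v) with hx
        have hx0 : 0 ≤ x := Real.sqrt_nonneg _
        have hx2 : x ^ 2 = L / v := Real.sq_sqrt (by positivity)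
        have hx1 : x ≤ 1 := Real.sqrt_le_one.2 ((div_le_one hv0).2 h)
        have hvL : Real.sqrt (v * L) = v * x := by
          rw [show v * L = (v * x) ^ 2 by rw [mul_pow, hx2]; field_simp,
            Real.sqrt_sq (by positivity)]
        have h1 : 6 * (v * x) ≤ s := by
          rw [← hvL]; linarith [le_max_left (Real.sqrt (v * L)) L]
        -- This slope gives (x/3)(6vx) − vx² = vx² = L.
        have h2 := dual_le_huber (s := s) hv0 (b := x / 3) (by linarith)
        have h3 : L = v * x ^ 2 := by rw [hx2]; field_simp
        nlinarith [mul_le_mul_of_nonneg_left h1 hx0]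
      · have h2 := dual_le_huber (s := s) hv0 (b := 1 / 3) le_rfl
        linarith [le_max_right (Real.sqrt (v * L)) L]
    calc r = prefactor ε v * (Real.exp L - 1) := by rw [hexp]; field_simp; ring
      _ ≤ _ := by unfold normPotential; gcongr
  rcases le_total S (6 * M) with h | h
  · nlinarith [primitive_nonneg hε hv hS]
  · have h0 := primitive_nonneg hε hv (show 0 ≤ 6 * M by linarith)
    have := le_of_hasDerivAt_nonneg (f := fun s => primitive ε v s - r * s) h
      (fun s => (hasDerivAt_primitive hv0 s).sub ((hasDerivAt_id s).const_mul r))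
      fun s h1 _ => by linarith [hψ s h1.le]
    linarith

end Step

/-! ### Regret against linear losses in a Hilbert space -/

section Regret

variable {E : Type*} [NormedAddCommGroup E] [InnerProductSpace ℝ E]

/-- The regret of the normalized algorithm on a sequence of linear losses of norm at most `1`. -/
theorem linear_regret_le {ε : ℝ} (hε : 0 < ε) (z : ℕ → E) (T : ℕ)
    (hz : ∀ t ∈ Finset.Icc 1 T, ‖z t‖ ≤ 1) (θ : ℕ → E) (hθ : ∀ t, θ t = ∑ s ∈ Finset.Ico 1 t, z s)
    (v : ℕ → ℝ) (hv : ∀ t, v t = 4 + ∑ s ∈ Finset.Ico 1 t, ‖z s‖ ^ 2) (U : E) :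
    ∑ t ∈ Finset.Icc 1 T,
        inner ℝ (z t) (-((normPotential ε (v t) ‖θ t‖ / ‖θ t‖) • θ t) - U) ≤
      4 * ε + 6 * ‖U‖ * max
        (Real.sqrt (v (T + 1) * Real.log (‖U‖ / prefactor ε (v (T + 1)) + 1)))
        (Real.log (‖U‖ / prefactor ε (v (T + 1)) + 1)) := by
  have hv4 : ∀ t, 4 ≤ v t := fun t => by
    rw [hv]; linarith [Finset.sum_nonneg fun s (_ : s ∈ Finset.Ico 1 t) => sq_nonneg ‖z s‖]
  -- Invariant: potential plus accumulated loss is at most the telescoped error; both sides vanish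
  -- at n = 0.
  have key : ∀ n ≤ T, primitive ε (v (n + 1)) ‖θ (n + 1)‖ + ∑ t ∈ Finset.Icc 1 n,
      inner ℝ (z t) (-((normPotential ε (v t) ‖θ t‖ / ‖θ t‖) • θ t)) ≤
      5 * ε * (1 / Real.log 4 - 1 / Real.log (v (n + 1))) := by
    intro n
    induction n with
    | zero => simp [hθ, hv]
    | succ n ih =>
      intro hn
      have ih := ih (by omega)
      have hθ' : θ (n + 1 + 1) = θ (n + 1) + z (n + 1) := by
        rw [hθ, hθ, Finset.sum_Ico_succ_top (by omega)]
      have hv' : v (n + 1 + 1) = v (n + 1) + ‖z (n + 1)‖ ^ 2 := by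
        rw [hv, hv, Finset.sum_Ico_succ_top (by omega), add_assoc]
      have h1 := primitive_step hε (hv4 (n + 1)) (norm_nonneg (θ (n + 1)))
        (norm_nonneg (z (n + 1))) (hz _ (Finset.mem_Icc.2 ⟨by omega, hn⟩))
        (norm_nonneg (θ (n + 1) + z (n + 1))) (abs_real_inner_le_norm _ _)
        (norm_add_sq_real _ _)
      have h2 := error_le (g := ‖z (n + 1)‖) hε (hv4 (n + 1))
      rw [← hv', ← hθ'] at h1
      rw [← hv'] at h2
      rw [Finset.sum_Icc_succ_top (by omega), inner_neg_right, inner_smul_right,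
        real_inner_comm]
      linarith
  have h1 := key T le_rfl
  have h2 := mul_sub_primitive_le (v := v (T + 1)) hε (by linarith [hv4 (T + 1)])
    (norm_nonneg U) (norm_nonneg (θ (T + 1)))
  have h3 : ∑ t ∈ Finset.Icc 1 T, inner ℝ (z t) U = inner ℝ (θ (T + 1)) U := by
    rw [hθ, sum_inner]; rfl
  have h4 : -inner ℝ (θ (T + 1)) U ≤ ‖θ (T + 1)‖ * ‖U‖ :=
    (neg_le_abs _).trans (abs_real_inner_le_norm _ _)
  have h5 : 5 * ε * (1 / Real.log 4) ≤ 4 * ε := by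
    have h6 := lt_log_of_four_le (x := 4) le_rfl
    have h7 : 1 / Real.log 4 ≤ 1 / (5 / 4) := one_div_le_one_div_of_le (by norm_num) (by linarith)
    nlinarith
  have h6 : 0 ≤ 5 * ε * (1 / Real.log (v (T + 1))) := by
    have := Real.log_pos (show 1 < v (T + 1) by linarith [hv4 (T + 1)])
    positivity
  simp only [inner_sub_right, Finset.sum_sub_distrib]
  linarith

end Regret

/-! ### Hilbert–Schmidt operators as vectors -/

section HilbertSchmidt

variable {H : Type*} [NormedAddCommGroup H] [InnerProductSpace ℝ H] [CompleteSpace H]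
  {F : Type*} [NormedAddCommGroup F] [InnerProductSpace ℝ F]

theorem hsNorm_nonneg (A : H →L[ℝ] F) : 0 ≤ hsNorm A := Real.sqrt_nonneg _

variable [FiniteDimensional ℝ F]

/-- The isometric embedding of the Hilbert-Schmidt operators into a Hilbert space given by the
images of an orthonormal basis under the adjoint. -/
def hsEmbed : (H →L[ℝ] F) →ₗ[ℝ]
    PiLp 2 (fun _ : Fin (Module.finrank ℝ F) => H) where
  toFun A := WithLp.toLp 2 fun j => ContinuousLinearMap.adjoint A (stdOrthonormalBasis ℝ F j)
  map_add' A B := by ext j; simp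
  map_smul' c A := by ext j; simp

@[simp] theorem hsEmbed_apply (A : H →L[ℝ] F) (j : Fin (Module.finrank ℝ F)) :
    hsEmbed A j = ContinuousLinearMap.adjoint A (stdOrthonormalBasis ℝ F j) := rfl

theorem norm_hsEmbed (A : H →L[ℝ] F) : ‖hsEmbed A‖ = hsNorm A := by
  have h := (hasSum_hsNorm_sq A (exists_hilbertBasis ℝ H).choose_spec.choose).unique
    (hasSum_norm_sq_hilbertBasis A _)
  rw [← sq_eq_sq₀ (norm_nonneg _) (hsNorm_nonneg A), h, PiLp.norm_sq_eq_of_L2]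
  rfl

/-- The adjoint of g ⊗ x sends e to ⟨g, e⟩x, and Parseval in `F` does the rest. This turns a linear
loss at A x into a linear loss at `A`. -/
theorem inner_hsEmbed_rankOne (g : F) (x : H) (A : H →L[ℝ] F) :
    inner ℝ (hsEmbed (InnerProductSpace.rankOne ℝ g x)) (hsEmbed A) = inner ℝ g (A x) := by
  rw [PiLp.inner_apply, ← (stdOrthonormalBasis ℝ F).sum_inner_mul_inner g (A x)]
  refine Finset.sum_congr rfl fun j _ => ?_
  simp [inner_smul_left, ContinuousLinearMap.adjoint_inner_right, real_inner_comm]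

theorem hsNorm_rankOne_sq (g : F) (x : H) :
    hsNorm (InnerProductSpace.rankOne ℝ g x) ^ 2 = ‖g‖ ^ 2 * ‖x‖ ^ 2 := by
  rw [← norm_hsEmbed, ← real_inner_self_eq_norm_sq, inner_hsEmbed_rankOne]
  simp [inner_smul_right, mul_comm]

end HilbertSchmidt

/-! ### Rescaling to G₀ = 1 -/

section Normalization

variable {ε G₀ : ℝ}

theorem alpha_eq_prefactor (hG₀ : 0 < G₀) (V : ℝ) :
    alpha ε G₀ V = prefactor ε (V / G₀ ^ 2) := by
  rw [alpha, prefactor, Real.sqrt_div' _ (sq_nonneg _), Real.sqrt_sq hG₀.le]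
  field_simp

theorem potential_eq_normPotential (hG₀ : 0 < G₀) {V : ℝ} (hV : 0 < V) (S : ℝ) :
    potential ε G₀ S V = normPotential ε (V / G₀ ^ 2) (S / G₀) := by
  have hv : 0 < V / G₀ ^ 2 := by positivity
  have h : S ≤ 6 * V / G₀ ↔ S / G₀ ≤ 6 * (V / G₀ ^ 2) := by
    rw [le_div_iff₀ hG₀, div_le_iff₀ hG₀]
    have : 6 * (V / G₀ ^ 2) * G₀ = 6 * V / G₀ := by field_simp
    rw [this, le_div_iff₀ hG₀]
  rw [potential, normPotential, alpha_eq_prefactor hG₀]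
  split_ifs with h1
  · rw [huber_of_le hv (h.1 h1)]
    congr 3; field_simp
  · rw [huber_of_ge hv (not_le.1 fun h2 => h1 (h.2 h2)).le]
    congr 3; field_simp

end Normalization

/-! ### The kernel recursion and its operator form -/

section Algorithm

theorem algV_eq {F : Type*} [NormedAddCommGroup F] (k : ℕ → ℕ → ℝ)
    (G₀ : ℝ) (g : ℕ → F) (t : ℕ) : algV k G₀ g (t + 1) =
      4 * G₀ ^ 2 + ∑ s ∈ Finset.Ico 1 (t + 1), ‖g s‖ ^ 2 * k s s := by
  induction t with
  | zero => simp [algV]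
  | succ t ih => rw [algV, ih, Finset.sum_Ico_succ_top (by omega : 1 ≤ t + 1), add_assoc]

theorem mul_sqrt_le_liftedLipschitz (k : ℕ → ℕ → ℝ) {G : ℝ} (hG : 0 ≤ G) {T t : ℕ}
    (ht : t ∈ Finset.Icc 1 T) : G * Real.sqrt (k t t) ≤ liftedLipschitz k G T :=
  mul_le_mul_of_nonneg_left
    (le_ciSup (f := fun t : Finset.Icc 1 T => Real.sqrt (k t t)) (Set.finite_range _).bddAbove
      ⟨t, ht⟩) hG

variable {F : Type*} [NormedAddCommGroup F] [InnerProductSpace ℝ F]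
  {H : Type*} [NormedAddCommGroup H] [InnerProductSpace ℝ H] [CompleteSpace H]

/-- Testing at w + g gives ‖g‖² ≤ f(w + g) − f(w) ≤ G‖g‖. -/
theorem norm_le_of_mem_subdifferential {f : F → ℝ} {G : ℝ≥0} (hf : LipschitzWith G f) {w g : F}
    (hg : g ∈ subdifferential f w) : ‖g‖ ≤ G := by
  have h1 := hg (w + g)
  have h2 := hf.dist_le_mul (w + g) w
  rw [add_sub_cancel_left, real_inner_self_eq_norm_sq] at h1
  rw [Real.dist_eq, dist_self_add_left] at h2
  have h3 := le_abs_self (f (w + g) - f w)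
  rcases (norm_nonneg g).eq_or_lt with h | h
  · rw [← h]; exact G.2
  · refine le_of_mul_le_mul_right ?_ h
    nlinarith

variable [FiniteDimensional ℝ F]

/-- Kernel trick: expanding the squared norm of the sum, the cross terms are k(s,t)⟨g_t, g_s⟩. -/
theorem algSqS_eq {k : ℕ → ℕ → ℝ} {φ : ℕ → H} (hk : ∀ s t, k s t = inner ℝ (φ s) (φ t))
    (g : ℕ → F) (t : ℕ) :
    algSqS k g (t + 1) =
      hsNorm (∑ s ∈ Finset.Ico 1 (t + 1), InnerProductSpace.rankOne ℝ (g s) (φ s)) ^ 2 := by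
  simp only [← norm_hsEmbed]
  induction t with
  | zero => simp [algSqS]
  | succ t ih =>
    rw [algSqS, ih, Finset.sum_Ico_succ_top (by omega : 1 ≤ t + 1), map_add, norm_add_sq_real,
      real_inner_comm, inner_hsEmbed_rankOne, norm_hsEmbed (InnerProductSpace.rankOne ℝ _ _),
      hsNorm_rankOne_sq, hk, real_inner_self_eq_norm_sq]
    have e : inner ℝ (g (t + 1)) ((∑ s ∈ Finset.Ico 1 (t + 1),
        InnerProductSpace.rankOne ℝ (g s) (φ s)) (φ (t + 1))) =
        ∑ s ∈ Finset.Icc 1 t, k s (t + 1) * inner ℝ (g (t + 1)) (g s) := by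
      simp only [_root_.sum_apply, inner_sum, InnerProductSpace.rankOne_apply,
        inner_smul_right, hk]
      rfl
    rw [e]
    ring

/-- The plays are the values of the underlying operators. -/
theorem play_eq_operatorIterate {k : ℕ → ℕ → ℝ} {φ : ℕ → H}
    (hk : ∀ s t, k s t = inner ℝ (φ s) (φ t)) (ε G₀ : ℝ) (g : ℕ → F) (t : ℕ) :
    play k ε G₀ g (t + 1) = operatorIterate φ ε G₀ g (t + 1) (φ (t + 1)) := by
  cases t with
  | zero => simp [play, operatorIterate]
  | succ t =>
    have hS : algS k g (t + 2) = hsNorm (∑ s ∈ Finset.Ico 1 (t + 2),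
        InnerProductSpace.rankOne ℝ (g s) (φ s)) := by
      rw [algS, algSqS_eq hk, Real.sqrt_sq (hsNorm_nonneg _)]
    have hV : algV k G₀ g (t + 2) = _ := algV_eq k G₀ g (t + 1)
    simp only [play, operatorIterate, hS, hV, hsNorm_rankOne_sq, hk, real_inner_self_eq_norm_sq]
    simp [_root_.sum_apply]
    rfl

theorem staticRegret_linear_le {ε G₀ : ℝ} (hε : 0 < ε) (hG₀ : 0 < G₀) (φ : ℕ → H) (g : ℕ → F)
    (T : ℕ) (hz : ∀ t ∈ Finset.Icc 1 T, ‖g t‖ * ‖φ t‖ ≤ G₀) (U : H →L[ℝ] F) (V : ℝ)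
    (hV : V = 4 * G₀ ^ 2 + ∑ t ∈ Finset.Icc 1 T, ‖g t‖ ^ 2 * ‖φ t‖ ^ 2) :
    ∑ t ∈ Finset.Icc 1 T, inner ℝ (g t) (operatorIterate φ ε G₀ g t (φ t) - U (φ t)) ≤
      4 * G₀ * ε + 6 * hsNorm U * max (Real.sqrt (V * Real.log (hsNorm U / alpha ε G₀ V + 1)))
        (G₀ * Real.log (hsNorm U / alpha ε G₀ V + 1)) := by
  set R : ℕ → H →L[ℝ] F := fun s => InnerProductSpace.rankOne ℝ (g s) (φ s) with hR
  have hRn : ∀ s, ‖hsEmbed (R s)‖ ^ 2 = ‖g s‖ ^ 2 * ‖φ s‖ ^ 2 := fun s => by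
    rw [norm_hsEmbed, hsNorm_rankOne_sq]
  set v : ℕ → ℝ := fun t => 4 + ∑ s ∈ Finset.Ico 1 t, ‖G₀⁻¹ • hsEmbed (R s)‖ ^ 2 with hv
  have hvV : ∀ t, (4 * G₀ ^ 2 + ∑ s ∈ Finset.Ico 1 t, hsNorm (R s) ^ 2) / G₀ ^ 2 = v t := by
    intro t
    simp only [hv, norm_smul, mul_pow, ← Finset.mul_sum, norm_hsEmbed, norm_inv,
      Real.norm_of_nonneg hG₀.le]
    field_simp
  have hvT : V / G₀ ^ 2 = v (T + 1) := by
    rw [← hvV, hV]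
    simp only [hR, hsNorm_rankOne_sq]
    rfl
  have hW : ∀ t, hsEmbed (operatorIterate φ ε G₀ g t) =
      -((normPotential ε (v t) ‖G₀⁻¹ • hsEmbed (∑ s ∈ Finset.Ico 1 t, R s)‖ /
        ‖G₀⁻¹ • hsEmbed (∑ s ∈ Finset.Ico 1 t, R s)‖) •
          (G₀⁻¹ • hsEmbed (∑ s ∈ Finset.Ico 1 t, R s))) := by
    intro t
    have hpos : 0 < 4 * G₀ ^ 2 + ∑ s ∈ Finset.Ico 1 t, hsNorm (R s) ^ 2 := by
      have := Finset.sum_nonneg fun s (_ : s ∈ Finset.Ico 1 t) => sq_nonneg (hsNorm (R s))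
      positivity
    simp only [operatorIterate]
    rw [potential_eq_normPotential hG₀ hpos, hvV, norm_smul, norm_hsEmbed, norm_inv,
      Real.norm_of_nonneg hG₀.le, map_smul, map_neg, smul_neg, smul_smul, inv_mul_eq_div]
    congr 2
    simp only [hR]
    field_simp
  have h := linear_regret_le hε (fun t => G₀⁻¹ • hsEmbed (R t)) T (fun t ht => by
      rw [norm_smul, norm_inv, Real.norm_of_nonneg hG₀.le, inv_mul_le_iff₀ hG₀, mul_one]
      refine le_trans (le_of_eq ?_) (hz t ht)
      rw [← sq_eq_sq₀ (norm_nonneg _) (by positivity), hRn, mul_pow])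
    (fun t => G₀⁻¹ • hsEmbed (∑ s ∈ Finset.Ico 1 t, R s))
    (fun t => by rw [map_sum, Finset.smul_sum]) v (fun t => rfl) (hsEmbed U)
  have hi : ∀ t, inner ℝ (G₀⁻¹ • hsEmbed (R t)) (hsEmbed (operatorIterate φ ε G₀ g t) - hsEmbed U) =
      G₀⁻¹ * inner ℝ (g t) (operatorIterate φ ε G₀ g t (φ t) - U (φ t)) := by
    intro t
    rw [← map_sub, real_inner_smul_left, inner_hsEmbed_rankOne, _root_.sub_apply]
  simp only [← hW, hi, ← Finset.mul_sum] at h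
  rw [inv_mul_le_iff₀ hG₀, norm_hsEmbed, ← hvT, ← alpha_eq_prefactor hG₀] at h
  refine h.trans (le_of_eq ?_)
  set L := Real.log (hsNorm U / alpha ε G₀ V + 1)
  have e : Real.sqrt (V * L) = G₀ * Real.sqrt (V / G₀ ^ 2 * L) := by
    rw [show V * L = G₀ ^ 2 * (V / G₀ ^ 2 * L) by field_simp, Real.sqrt_mul (sq_nonneg _),
      Real.sqrt_sq hG₀.le]
  rw [e, ← mul_max_of_nonneg _ _ hG₀.le]
  ring

end Algorithm

end KernelOCO

end

/-! ### From convex losses to linear ones -/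

open KernelOCO in
theorem mainTheorem9
    {X H : Type*} [NormedAddCommGroup H] [InnerProductSpace ℝ H] [CompleteSpace H]
    [RKHS ℝ H X ℝ] {d T : ℕ}
    -- `τ t` is the point of the index set `X` that stands for the time `t`
    (τ : ℕ → X)
    (k : ℕ → ℕ → ℝ) (hk : k = fun s t => repKernel H (τ s) (τ t))
    (φ : ℕ → H) (hφ : φ = fun t => feature H (τ t))
    (G : ℝ≥0) (ε : ℝ) (hε : 0 < ε)
    (G₀ : ℝ) (hG₀ : G₀ = liftedLipschitz k G T) (hG₀_pos : 0 < G₀)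
    (ℓ : ℕ → EuclideanSpace ℝ (Fin d) → ℝ)
    (hconv : ∀ t ∈ Finset.Icc 1 T, ConvexOn ℝ Set.univ (ℓ t))
    (hlip : ∀ t ∈ Finset.Icc 1 T, LipschitzWith G (ℓ t))
    (g w : ℕ → EuclideanSpace ℝ (Fin d))
    (hw : w = play k ε G₀ g)
    (hg : ∀ t ∈ Finset.Icc 1 T, g t ∈ subdifferential (ℓ t) (w t))
    (u : ℕ → EuclideanSpace ℝ (Fin d)) (U : H →L[ℝ] EuclideanSpace ℝ (Fin d))
    (hU : ∀ t ∈ Finset.Icc 1 T, u t = U (φ t))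
    (V α : ℝ)
    (hV : V = 4 * G₀ ^ 2 + ∑ t ∈ Finset.Icc 1 T, ‖g t‖ ^ 2 * k t t)
    (hα : α = ε * G₀ / (Real.sqrt V * Real.log (V / G₀ ^ 2) ^ 2)) :
    dynamicRegret T ℓ w u =
        staticRegret T (fun t (W : H →L[ℝ] EuclideanSpace ℝ (Fin d)) => ℓ t (W (φ t)))
          (operatorIterate φ ε G₀ g) U ∧
      dynamicRegret T ℓ w u ≤
        4 * G₀ * ε + 6 * hsNorm U *
          max (Real.sqrt (V * Real.log (hsNorm U / α + 1)))
            (G₀ * Real.log (hsNorm U / α + 1)) := by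
  have hkφ : ∀ s t, k s t = inner ℝ (φ s) (φ t) := fun s t => by
    rw [hk, hφ]; exact repKernel_eq_inner _ _
  have hkn : ∀ t, k t t = ‖φ t‖ ^ 2 := fun t => by rw [hkφ, real_inner_self_eq_norm_sq]
  have hwW : ∀ t ∈ Finset.Icc 1 T, w t = operatorIterate φ ε G₀ g t (φ t) := fun t ht => by
    obtain ⟨n, rfl⟩ := Nat.exists_eq_add_of_le' (Finset.mem_Icc.1 ht).1
    rw [hw, play_eq_operatorIterate hkφ]
  have hz : ∀ t ∈ Finset.Icc 1 T, ‖g t‖ * ‖φ t‖ ≤ G₀ := fun t ht => by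
    have h1 := mul_sqrt_le_liftedLipschitz k G.2 ht
    rw [hkn, Real.sqrt_sq (norm_nonneg _)] at h1
    rw [hG₀]
    exact (mul_le_mul_of_nonneg_right (norm_le_of_mem_subdifferential (hlip t ht) (hg t ht))
      (norm_nonneg _)).trans h1
  refine ⟨Finset.sum_congr rfl fun t ht => by simp only [hwW t ht, hU t ht], ?_⟩
  have h := staticRegret_linear_le hε hG₀_pos φ g T hz U V (by simp only [hV, hkn])
  rw [alpha, ← hα] at h
  -- Each regret term is at most its linearization, by the subgradient inequality at u_t.
  refine le_trans (Finset.sum_le_sum fun t ht => ?_) h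
  have h1 := hg t ht (u t)
  rw [← hwW t ht, ← hU t ht, ← neg_sub (u t), inner_neg_right]
  linarith
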